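/- A sequence $Q=(q_n)_{n\ge 1}$ of integers $q_n\ge 2$ is called a basic sequence. Every real $x$ has a unique $Q$-Cantor series expansion $$x=E_0+\sum_{n=1}^\infty \frac{E_n}{q_1q_2\cdots q_n},\qquad E_0=\lfloor x\rfloor,\quad E_n\in\{0,1,\dots,q_n-1\}\ (n\ge 1),\quad E_n\ne q_n-1 \text{ for infinitely many } n.$$ For basic sequences $P=(p_n)$ and $Q=(q_n)$ and a real $x$ whose $P$-Cantor series expansion has digits $E_0,E_1,E_2,\dots$, put $$\psi_{P,Q}(x)=\sum_{n=1}^\infty \frac{\min(E_n,q_n-1)}{q_1q_2\cdots q_n}.$$ Let $L_{P,Q}(w)=\{x\in(0,1):\psi_{P,Q}(x)=w\}$ and, for $\alpha\in[0,1]$, let $$V_{P,Q}(\alpha)=\{w\in\psi_{P,Q}((0,1)) : \dim_H L_{P,Q}(w)=\alpha\},$$ where $\dim_H$ is Hausdorff dimension. Let $\tau_n=n(n+1)/2$. A sequence of real numbers $(s_n)$ is said to grow nicely if it is eventually non-decreasing, $\lim_{n\to\infty}s_n=\infty$, and $$\lim_{n\to\infty}\frac{\log s_{\tau_{n+2}}}{\log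 s_{\tau_n}}=1.$$ Theorem. Let $P=(p_n)$ and $Q=(q_n)$ be basic sequences and let $r_n=p_n-q_n$. Suppose that $(p_n)$, $(q_n)$ and $(r_n)$ grow nicely, that $p_n>q_n$ for all $n\ge 1$, and that $$\lim_{n\to\infty}\frac{\log r_n}{\log p_n}=\gamma\in(0,1].$$ Then for all $\alpha\in[0,1]$ $$\dim_H V_{P,Q}(\alpha)\ \ge\ 1-\frac{\alpha}{\gamma}.$$ In particular, $\dim_H V_{P,Q}(\alpha)>0$ if $0\le\alpha<\gamma$. -/

import Mathlib

open Filter Topology Set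

/-- `Q = (q_n)_{n ≥ 1}` is a basic sequence: integers with `q_n ≥ 2`.
Sequences are indexed from `1`; the value at `0` is never used. -/
def IsBasicSequence (Q : ℕ → ℕ) : Prop := ∀ n, 1 ≤ n → 2 ≤ Q n

/-- The product `q_1 q_2 ⋯ q_n`. -/
def cantorProd (Q : ℕ → ℕ) (n : ℕ) : ℕ := ∏ j ∈ Finset.Icc 1 n, Q j

/-- `x = E₀.E_1E_2E_3… w.r.t. Q`, i.e. `x = E₀ + ∑_{n ≥ 1} E_n / (q_1 ⋯ q_n)` where `E₀ = ⌊x⌋`,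
`E_n ∈ {0, …, q_n - 1}` for `n ≥ 1` and `E_n ≠ q_n - 1` infinitely often. -/
def IsCantorExpansion (Q : ℕ → ℕ) (x : ℝ) (E₀ : ℤ) (E : ℕ → ℕ) : Prop :=
  E₀ = ⌊x⌋ ∧ (∀ n, 1 ≤ n → E n < Q n) ∧ (∀ N, ∃ n, N ≤ n ∧ 1 ≤ n ∧ E n ≠ Q n - 1) ∧
    HasSum (fun n : ℕ => (E (n + 1) : ℝ) / cantorProd Q (n + 1)) (x - E₀)

/-- The digit `E_n`, `n ≥ 1`, of the `Q`-Cantor series expansion of `x`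
(see `isCantorExpansion_iff`). -/
noncomputable def cantorDigit (Q : ℕ → ℕ) (x : ℝ) (n : ℕ) : ℕ :=
  ⌊(cantorProd Q n : ℝ) * Int.fract x⌋₊ % Q n

theorem cantorProd_zero (Q : ℕ → ℕ) : cantorProd Q 0 = 1 := by simp [cantorProd]

theorem cantorProd_succ (Q : ℕ → ℕ) (n : ℕ) :
    cantorProd Q (n + 1) = cantorProd Q n * Q (n + 1) := by
  simp [cantorProd, Finset.prod_Icc_succ_top]

theorem two_pow_le_cantorProd {Q : ℕ → ℕ} (hQ : IsBasicSequence Q) (n : ℕ) :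
    2 ^ n ≤ cantorProd Q n := by
  induction n with
  | zero => simp [cantorProd_zero]
  | succ n ih =>
    rw [cantorProd_succ, pow_succ]
    exact Nat.mul_le_mul ih (hQ _ (by omega))

theorem cantorProd_pos {Q : ℕ → ℕ} (hQ : IsBasicSequence Q) (n : ℕ) :
    (0 : ℝ) < cantorProd Q n := by
  have h := two_pow_le_cantorProd hQ n
  have h2 : 0 < 2 ^ n := by positivity
  exact_mod_cast lt_of_lt_of_le h2 h

theorem tendsto_inv_cantorProd {Q : ℕ → ℕ} (hQ : IsBasicSequence Q) :
    Tendsto (fun n => 1 / (cantorProd Q n : ℝ)) atTop (𝓝 0) := by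
  refine squeeze_zero (fun n => by positivity) (fun n => ?_)
    (tendsto_pow_atTop_nhds_zero_of_lt_one (r := (1 / 2 : ℝ)) (by norm_num) (by norm_num))
  rw [one_div_pow]
  have h : ((2 : ℝ) ^ n) ≤ cantorProd Q n := by exact_mod_cast two_pow_le_cantorProd hQ n
  exact one_div_le_one_div_of_le (by positivity) h

/-- Numerators of the partial sums of a Cantor series. -/
def cantorNum (Q E : ℕ → ℕ) : ℕ → ℕ
  | 0 => 0
  | n + 1 => cantorNum Q E n * Q (n + 1) + E (n + 1)

theorem cantor_partialSum {Q : ℕ → ℕ} (hQ : IsBasicSequence Q) (E : ℕ → ℕ) (n : ℕ) :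
    ∑ k ∈ Finset.range n, (E (k + 1) : ℝ) / cantorProd Q (k + 1)
      = cantorNum Q E n / cantorProd Q n := by
  induction n with
  | zero => simp [cantorNum]
  | succ n ih =>
    have h1 := cantorProd_pos hQ n
    have h2 : (0 : ℝ) < Q (n + 1) := by
      have := hQ (n + 1) (by omega)
      exact_mod_cast (by omega : 0 < Q (n + 1))
    rw [Finset.sum_range_succ, ih, cantorProd_succ, cantorNum]
    push_cast
    field_simp

theorem cantorNum_digit {Q : ℕ → ℕ} (hQ : IsBasicSequence Q) (x : ℝ) (n : ℕ) :
    cantorNum Q (cantorDigit Q x) n = ⌊(cantorProd Q n : ℝ) * Int.fract x⌋₊ := by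
  induction n with
  | zero =>
    have : ⌊Int.fract x⌋₊ = 0 := Nat.floor_eq_zero.2 (Int.fract_lt_one x)
    simp [cantorNum, cantorProd_zero, this]
  | succ n ih =>
    have h2 : (0 : ℝ) < Q (n + 1) := by
      have := hQ (n + 1) (by omega)
      exact_mod_cast (by omega : 0 < Q (n + 1))
    have h3 : ⌊(cantorProd Q n : ℝ) * Int.fract x⌋₊
        = ⌊(cantorProd Q (n + 1) : ℝ) * Int.fract x⌋₊ / Q (n + 1) := by
      rw [← Nat.floor_div_natCast]
      congr 1
      rw [cantorProd_succ]
      push_cast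
      field_simp
    rw [cantorNum, ih, cantorDigit, h3, mul_comm]
    exact Nat.div_add_mod _ _

/-- Upper ends `(G_n + 1) / (q_1 ⋯ q_n)` of the cylinders do not increase, and they strictly
decrease at digits different from `q_n - 1`. -/
theorem cantor_upper_succ {Q : ℕ → ℕ} (hQ : IsBasicSequence Q) (E : ℕ → ℕ) (n : ℕ) :
    ((cantorNum Q E (n + 1) : ℝ) + 1) / cantorProd Q (n + 1)
      = ((cantorNum Q E n : ℝ) + 1) / cantorProd Q n
        - ((Q (n + 1) : ℝ) - 1 - E (n + 1)) / cantorProd Q (n + 1) := by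
  have h1 := cantorProd_pos hQ n
  have h2 : (0 : ℝ) < Q (n + 1) := by
    have := hQ (n + 1) (by omega)
    exact_mod_cast (by omega : 0 < Q (n + 1))
  rw [cantorProd_succ, cantorNum]
  push_cast
  field_simp
  ring

theorem cantorDigit_lt {Q : ℕ → ℕ} (hQ : IsBasicSequence Q) (x : ℝ) {n : ℕ} (hn : 1 ≤ n) :
    cantorDigit Q x n < Q n :=
  Nat.mod_lt _ (by have := hQ n hn; omega)

/-- Every real has exactly one `Q`-Cantor series expansion, and its digits are `cantorDigit`. -/
theorem isCantorExpansion_iff {Q : ℕ → ℕ} (hQ : IsBasicSequence Q) (x : ℝ) (E₀ : ℤ) (E : ℕ → ℕ) :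
    IsCantorExpansion Q x E₀ E ↔ E₀ = ⌊x⌋ ∧ ∀ n, 1 ≤ n → E n = cantorDigit Q x n := by
  have hinv := tendsto_inv_cantorProd hQ
  have key : ∀ E : ℕ → ℕ, ∀ y : ℝ,
      HasSum (fun n : ℕ => (E (n + 1) : ℝ) / cantorProd Q (n + 1)) y ↔
        Tendsto (fun n => (cantorNum Q E n : ℝ) / cantorProd Q n) atTop (𝓝 y) := by
    intro E y
    rw [hasSum_iff_tendsto_nat_of_nonneg (fun n => by positivity)]
    simp only [cantor_partialSum hQ]
  have keyT : ∀ E : ℕ → ℕ, ∀ y : ℝ,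
      Tendsto (fun n => (cantorNum Q E n : ℝ) / cantorProd Q n) atTop (𝓝 y) →
        Tendsto (fun n => ((cantorNum Q E n : ℝ) + 1) / cantorProd Q n) atTop (𝓝 y) := by
    intro E y h
    have := h.add hinv
    simpa [add_div] using this
  constructor
  · rintro ⟨rfl, hlt, hinf, hsum⟩
    refine ⟨rfl, ?_⟩
    have hy : x - (⌊x⌋ : ℝ) = Int.fract x := rfl
    rw [hy] at hsum
    have hT := keyT E _ ((key E _).1 hsum)
    have hgap : ∀ n, (0 : ℝ) ≤ ((Q (n + 1) : ℝ) - 1 - E (n + 1)) := by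
      intro n
      have : (E (n + 1) : ℝ) + 1 ≤ Q (n + 1) := by exact_mod_cast hlt (n + 1) (by omega)
      linarith
    have hanti : Antitone (fun n => ((cantorNum Q E n : ℝ) + 1) / cantorProd Q n) := by
      refine antitone_nat_of_succ_le fun n => ?_
      rw [cantor_upper_succ hQ]
      have := div_nonneg (hgap n) (cantorProd_pos hQ (n + 1)).le
      linarith
    have hfl : ∀ n, cantorNum Q E n = ⌊(cantorProd Q n : ℝ) * Int.fract x⌋₊ := by
      intro n
      have hp := cantorProd_pos hQ n
      symm
      rw [Nat.floor_eq_iff (mul_nonneg hp.le (Int.fract_nonneg x))]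
      constructor
      · have h1 := sum_le_hasSum (Finset.range n) (fun i _ => by positivity) hsum
        rw [cantor_partialSum hQ, div_le_iff₀ hp] at h1
        linarith
      · obtain ⟨m, hm, hm1, hmE⟩ := hinf (n + 1)
        obtain ⟨k, rfl⟩ : ∃ k, m = k + 1 := ⟨m - 1, by omega⟩
        have h1 := hanti.le_of_tendsto hT (k + 1)
        have h2 := hanti (show n ≤ k by omega)
        have h3 : (0 : ℝ) < ((Q (k + 1) : ℝ) - 1 - E (k + 1)) := by
          have h5 := hlt (k + 1) hm1
          have : (E (k + 1) : ℝ) + 1 < Q (k + 1) := by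
            exact_mod_cast (by omega : E (k + 1) + 1 < Q (k + 1))
          linarith
        have h4 := div_pos h3 (cantorProd_pos hQ (k + 1))
        have h6 := cantor_upper_succ hQ E k
        simp only at h1 h2
        have h7 : Int.fract x < ((cantorNum Q E n : ℝ) + 1) / cantorProd Q n := by linarith
        rw [lt_div_iff₀ hp] at h7
        linarith
    intro n hn
    obtain ⟨k, rfl⟩ : ∃ k, n = k + 1 := ⟨n - 1, by omega⟩
    rw [cantorDigit, ← hfl, cantorNum, Nat.mul_add_mod_self_right, Nat.mod_eq_of_lt (hlt _ hn)]
  · rintro ⟨rfl, hE⟩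
    have hlt : ∀ n, 1 ≤ n → E n < Q n := fun n hn => by
      rw [hE n hn]; exact cantorDigit_lt hQ x hn
    have hnum : ∀ n, cantorNum Q E n = ⌊(cantorProd Q n : ℝ) * Int.fract x⌋₊ := by
      intro n
      rw [← cantorNum_digit hQ]
      induction n with
      | zero => rfl
      | succ n ih => rw [cantorNum, cantorNum, ih, hE (n + 1) (by omega)]
    have hup : ∀ n, Int.fract x < ((cantorNum Q E n : ℝ) + 1) / cantorProd Q n := by
      intro n
      rw [lt_div_iff₀ (cantorProd_pos hQ n), hnum, mul_comm]
      exact Nat.lt_floor_add_one _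
    have hlow : ∀ n, (cantorNum Q E n : ℝ) / cantorProd Q n ≤ Int.fract x := by
      intro n
      have hp := cantorProd_pos hQ n
      rw [div_le_iff₀ hp, hnum, mul_comm (Int.fract x)]
      exact Nat.floor_le (mul_nonneg hp.le (Int.fract_nonneg x))
    have hlim : Tendsto (fun n => (cantorNum Q E n : ℝ) / cantorProd Q n) atTop
        (𝓝 (Int.fract x)) := by
      have h0 : Tendsto (fun n => Int.fract x - 1 / (cantorProd Q n : ℝ)) atTop
          (𝓝 (Int.fract x)) := by
        simpa using tendsto_const_nhds.sub hinv
      refine tendsto_of_tendsto_of_tendsto_of_le_of_le h0 tendsto_const_nhds (fun n => ?_) hlow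
      have := hup n
      rw [add_div] at this
      simp only
      linarith
    refine ⟨rfl, hlt, ?_, (key E _).2 hlim⟩
    by_contra hcon
    push Not at hcon
    obtain ⟨N, hN⟩ := hcon
    have hconst : ∀ k, ((cantorNum Q E (N + k) : ℝ) + 1) / cantorProd Q (N + k)
        = ((cantorNum Q E N : ℝ) + 1) / cantorProd Q N := by
      intro k
      induction k with
      | zero => rfl
      | succ k ih =>
        have h1 := hN (N + k + 1) (by omega) (by omega)
        have h2 := hQ (N + k + 1) (by omega)
        have h3 : (E (N + k + 1) : ℝ) + 1 = Q (N + k + 1) := by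
          exact_mod_cast (by omega : E (N + k + 1) + 1 = Q (N + k + 1))
        rw [← add_assoc, cantor_upper_succ hQ, ih, ← h3]
        simp
    have h1 := (keyT E _ hlim).comp (tendsto_add_atTop_nat N)
    have h2 : Tendsto (fun _ : ℕ => ((cantorNum Q E N : ℝ) + 1) / cantorProd Q N) atTop
        (𝓝 (Int.fract x)) := by
      refine h1.congr fun k => ?_
      simp only [Function.comp]
      rw [add_comm k N, hconst]
    exact absurd (tendsto_nhds_unique h2 tendsto_const_nhds) (hup N).ne

/-- `ψ_{P,Q}(x) = ∑_{n ≥ 1} min(E_n, q_n - 1) / (q_1 ⋯ q_n)`, where `x = E₀.E_1E_2… w.r.t. P`. -/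
noncomputable def psi (P Q : ℕ → ℕ) (x : ℝ) : ℝ :=
  ∑' n : ℕ, (min (cantorDigit P x (n + 1)) (Q (n + 1) - 1) : ℝ) / cantorProd Q (n + 1)

/-- The series defining `psi` converges. -/
theorem summable_psi (P : ℕ → ℕ) {Q : ℕ → ℕ} (hQ : IsBasicSequence Q) (x : ℝ) :
    Summable (fun n : ℕ =>
      (min (cantorDigit P x (n + 1)) (Q (n + 1) - 1) : ℝ) / cantorProd Q (n + 1)) := by
  have hq : ∀ n : ℕ, (2 : ℝ) ≤ Q (n + 1) := fun n => by exact_mod_cast hQ (n + 1) (by omega)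
  refine Summable.of_nonneg_of_le (fun n => ?_) (fun n => ?_)
    (summable_geometric_of_lt_one (r := (1 / 2 : ℝ)) (by norm_num) (by norm_num))
  · exact div_nonneg (le_min (by positivity) (by linarith [hq n])) (by positivity)
  · have h1 := cantorProd_pos hQ n
    have h2 : ((2 : ℝ) ^ n) ≤ cantorProd Q n := by exact_mod_cast two_pow_le_cantorProd hQ n
    have h3 := hq n
    calc (min (cantorDigit P x (n + 1)) (Q (n + 1) - 1) : ℝ) / cantorProd Q (n + 1)
        ≤ (Q (n + 1) : ℝ) / cantorProd Q (n + 1) := by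
          gcongr
          exact (min_le_right _ _).trans (by linarith)
      _ = 1 / cantorProd Q n := by
          rw [cantorProd_succ]; push_cast; field_simp
      _ ≤ (1 / 2) ^ n := by
          rw [one_div_pow]; exact one_div_le_one_div_of_le (by positivity) h2

/-- The level set `L_{P,Q}(w) = {x ∈ (0,1) : ψ_{P,Q}(x) = w}`. -/
def levelSet (P Q : ℕ → ℕ) (w : ℝ) : Set ℝ := {x | x ∈ Ioo (0 : ℝ) 1 ∧ psi P Q x = w}

/-- `V_{P,Q}(α)`: the `w ∈ ψ_{P,Q}((0,1))` whose level set has Hausdorff dimension `α`. -/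
noncomputable def dimLevelSet (P Q : ℕ → ℕ) (α : ℝ) : Set ℝ :=
  {w | w ∈ psi P Q '' Ioo (0 : ℝ) 1 ∧ dimH (levelSet P Q w) = ENNReal.ofReal α}

/-- The triangular number `τ_n = n (n + 1) / 2`. -/
def triangular (n : ℕ) : ℕ := n * (n + 1) / 2

/-- The real sequence `s` grows nicely: it is eventually non-decreasing, tends to infinity, and
`log s_{τ_{n+2}} / log s_{τ_n} → 1`. -/
def GrowsNicely (s : ℕ → ℝ) : Prop :=
  (∃ N, ∀ m n, N ≤ m → m ≤ n → s m ≤ s n) ∧ Tendsto s atTop atTop ∧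
    Tendsto (fun n => Real.log (s (triangular (n + 2))) / Real.log (s (triangular n)))
      atTop (𝓝 1)

/-! For `α < γ` put `ρ = α / γ` and fix a set `S` of indices of density `ρ`. Let `w` have `Q`-digits
equal to `q_n - 1` on `S`, smaller than `q_n - 1` off `S`, and not eventually zero. Such a digit
sequence is the only one with value `w`, so `x` lies over `w` exactly when its `P`-digits agree with
those of `w` off `S` and are at least `q_n - 1` on `S`, which leaves `r_n + 1` choices there. The
level set is thus a homogeneous Cantor set, of dimension `lim ∑_{k ∈ S, k ≤ n} log r_k / ∑_{k ≤ n}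
log p_k = γρ = α` (`IsLevelDigits.dimH_levelSet`). The admissible `w` have about `q_n` free digits
off `S`, so they contain a Cantor set of dimension `1 - ρ`. For `α ≥ γ` the bound is trivial.

Nice growth enters twice. It makes `log p_{n+1}` negligible against `log (p_1 ⋯ p_n)`
(`GrowsNicely.tendsto_log_div_sum`), so the covering bound `dimH_le_of_digits` and the Hölder bound
`le_dimH_of_digits` agree. Eventual monotonicity lets summation by parts show that `S` keeps density
`ρ` under the weights `log p_n` (`tendsto_weighted_sum_div`). -/

/-! ### Cantor series with prescribed digits. -/

/-- The value `∑_{n ≥ 1} E_n / (q_1 ⋯ q_n)` of a Cantor series. -/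
noncomputable def cantorVal (Q E : ℕ → ℕ) : ℝ :=
  ∑' n : ℕ, (E (n + 1) : ℝ) / cantorProd Q (n + 1)

theorem hasSum_cantor_max {Q : ℕ → ℕ} (hQ : IsBasicSequence Q) :
    HasSum (fun n : ℕ => ((Q (n + 1) - 1 : ℕ) : ℝ) / cantorProd Q (n + 1)) 1 := by
  rw [hasSum_iff_tendsto_nat_of_nonneg (fun n => by positivity)]
  have h : ∀ n, ∑ k ∈ Finset.range n, ((Q (k + 1) - 1 : ℕ) : ℝ) / cantorProd Q (k + 1)
      = 1 - 1 / cantorProd Q n := by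
    intro n
    induction n with
    | zero => simp [cantorProd_zero]
    | succ n ih =>
      have h1 := cantorProd_pos hQ n
      have h3 := hQ (n + 1) (by omega)
      have h2 : (0 : ℝ) < Q (n + 1) := by exact_mod_cast (by omega : 0 < Q (n + 1))
      rw [Finset.sum_range_succ, ih, cantorProd_succ, Nat.cast_sub (by omega)]
      push_cast
      field_simp
      ring
  simp only [h]
  simpa using tendsto_const_nhds.sub (tendsto_inv_cantorProd hQ)

theorem hasSum_cantorVal {Q E : ℕ → ℕ} (hQ : IsBasicSequence Q)
    (hE : ∀ n, 1 ≤ n → E n < Q n) :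
    HasSum (fun n : ℕ => (E (n + 1) : ℝ) / cantorProd Q (n + 1)) (cantorVal Q E) := by
  refine (Summable.of_nonneg_of_le (fun n => by positivity) (fun n => ?_)
    (hasSum_cantor_max hQ).summable).hasSum
  have := hE (n + 1) (by omega)
  gcongr
  omega

theorem isCantorExpansion_cantorVal {Q E : ℕ → ℕ} (hQ : IsBasicSequence Q)
    (hE : ∀ n, 1 ≤ n → E n < Q n) (hmax : ∀ N, ∃ n, N ≤ n ∧ 1 ≤ n ∧ E n ≠ Q n - 1) :
    IsCantorExpansion Q (cantorVal Q E) 0 E := by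
  refine ⟨?_, hE, hmax, by simpa using hasSum_cantorVal hQ hE⟩
  symm
  rw [Int.floor_eq_zero_iff]
  refine ⟨tsum_nonneg fun n => by positivity, ?_⟩
  obtain ⟨m, -, hm1, hm⟩ := hmax 0
  obtain ⟨k, rfl⟩ : ∃ k, m = k + 1 := ⟨m - 1, by omega⟩
  -- Comparison with the all-maximal series, whose sum is 1; strictness comes from one non-maximal
  -- digit.
  refine hasSum_lt (i := k) (fun n => ?_) ?_ (hasSum_cantorVal hQ hE) (hasSum_cantor_max hQ)
  · have := hE (n + 1) (by omega)
    gcongr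
    omega
  · have h1 := hE (k + 1) (by omega)
    have := cantorProd_pos hQ (k + 1)
    have : E (k + 1) < Q (k + 1) - 1 := by omega
    gcongr

theorem cantorDigit_cantorVal {Q E : ℕ → ℕ} (hQ : IsBasicSequence Q)
    (hE : ∀ n, 1 ≤ n → E n < Q n) (hmax : ∀ N, ∃ n, N ≤ n ∧ 1 ≤ n ∧ E n ≠ Q n - 1) {n : ℕ}
    (hn : 1 ≤ n) : cantorDigit Q (cantorVal Q E) n = E n :=
  (((isCantorExpansion_iff hQ _ _ _).1 (isCantorExpansion_cantorVal hQ hE hmax)).2 n hn).symm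

theorem cantorVal_mem_Ico {Q E : ℕ → ℕ} (hQ : IsBasicSequence Q)
    (hE : ∀ n, 1 ≤ n → E n < Q n) (hmax : ∀ N, ∃ n, N ≤ n ∧ 1 ≤ n ∧ E n ≠ Q n - 1) :
    cantorVal Q E ∈ Ico (0 : ℝ) 1 :=
  Int.floor_eq_zero_iff.1 (isCantorExpansion_cantorVal hQ hE hmax).1.symm

theorem cantorVal_reflect {Q E : ℕ → ℕ} (hQ : IsBasicSequence Q)
    (hE : ∀ n, 1 ≤ n → E n < Q n) :
    cantorVal Q (fun n => Q n - 1 - E n) = 1 - cantorVal Q E := by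
  rw [← ((hasSum_cantor_max hQ).sub (hasSum_cantorVal hQ hE)).tsum_eq]
  refine tsum_congr fun n => ?_
  have := hE (n + 1) (by omega)
  rw [Nat.cast_sub (by omega), sub_div]

/-- A Cantor series with digits that are neither eventually zero nor eventually maximal determines
its digits among all Cantor series. -/
theorem digits_eq_of_cantorVal_eq {Q F G : ℕ → ℕ} (hQ : IsBasicSequence Q)
    (hF : ∀ n, 1 ≤ n → F n < Q n) (hG : ∀ n, 1 ≤ n → G n < Q n)
    (hFmax : ∀ N, ∃ n, N ≤ n ∧ 1 ≤ n ∧ F n ≠ Q n - 1)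
    (hFzero : ∀ N, ∃ n, N ≤ n ∧ 1 ≤ n ∧ F n ≠ 0)
    (h : cantorVal Q G = cantorVal Q F) {n : ℕ} (hn : 1 ≤ n) : G n = F n := by
  by_cases hGmax : ∀ N, ∃ n, N ≤ n ∧ 1 ≤ n ∧ G n ≠ Q n - 1
  · rw [← cantorDigit_cantorVal hQ hF hFmax hn, ← h, cantorDigit_cantorVal hQ hG hGmax hn]
  -- If `G` ends in maximal digits, reflect both sequences by `E ↦ q - 1 - E`. The reflected `G`
  -- ends in zeros, and the reflected `F` is not eventually maximal because `F` is not eventually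
  -- zero, so uniqueness of expansions applies.
  · push Not at hGmax
    obtain ⟨N, hN⟩ := hGmax
    have hrefl : ∀ E : ℕ → ℕ, ∀ n, 1 ≤ n → Q n - 1 - E n < Q n := fun E n hn => by
      have := hQ n hn
      omega
    have h1 := cantorDigit_cantorVal hQ (hrefl F) (fun N => by
      obtain ⟨n, h1, h2, h3⟩ := hFzero N
      have := hF n h2
      exact ⟨n, h1, h2, by omega⟩) hn
    have h2 := cantorDigit_cantorVal hQ (hrefl G) (fun M => by
      refine ⟨M + N + 1, by omega, by omega, ?_⟩
      have h1 := hN (M + N + 1) (by omega) (by omega)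
      have := hQ (M + N + 1) (by omega)
      omega) hn
    rw [cantorVal_reflect hQ hF] at h1
    rw [cantorVal_reflect hQ hG, h, h1] at h2
    have := hF n hn
    have := hG n hn
    omega

theorem cantorNum_div_le_cantorVal {Q E : ℕ → ℕ} (hQ : IsBasicSequence Q)
    (hE : ∀ n, 1 ≤ n → E n < Q n) (n : ℕ) :
    (cantorNum Q E n : ℝ) / cantorProd Q n ≤ cantorVal Q E := by
  rw [← cantor_partialSum hQ]
  exact sum_le_hasSum (Finset.range n) (fun i _ => by positivity) (hasSum_cantorVal hQ hE)

theorem cantorVal_le_cantorNum_div {Q E : ℕ → ℕ} (hQ : IsBasicSequence Q)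
    (hE : ∀ n, 1 ≤ n → E n < Q n) (n : ℕ) :
    cantorVal Q E ≤ ((cantorNum Q E n : ℝ) + 1) / cantorProd Q n := by
  have hanti : Antitone (fun n => ((cantorNum Q E n : ℝ) + 1) / cantorProd Q n) := by
    refine antitone_nat_of_succ_le fun n => ?_
    rw [cantor_upper_succ hQ]
    have h1 : (0 : ℝ) ≤ ((Q (n + 1) : ℝ) - 1 - E (n + 1)) := by
      have : (E (n + 1) : ℝ) + 1 ≤ Q (n + 1) := by exact_mod_cast hE (n + 1) (by omega)
      linarith
    have := div_nonneg h1 (cantorProd_pos hQ (n + 1)).le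
    linarith
  refine hanti.le_of_tendsto ?_ n
  have h1 := (hasSum_cantorVal hQ hE).tendsto_sum_nat
  simp only [cantor_partialSum hQ] at h1
  simpa [add_div] using h1.add (tendsto_inv_cantorProd hQ)

/-! ### Lower bound for the dimension of homogeneous Cantor sets. -/

theorem cantorProd_pos_of_one_le {N : ℕ → ℕ} (hN : ∀ n, 1 ≤ n → 1 ≤ N n) (n : ℕ) :
    0 < cantorProd N n :=
  Finset.prod_pos fun j hj => hN j (Finset.mem_Icc.1 hj).1

/-- Here base 1 must be allowed, unlike in `cantorNum_digit`: `N n` counts the admissible digits,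
and a forced digit counts once. -/
theorem cantorNum_cantorDigit {N : ℕ → ℕ} (hN : ∀ n, 1 ≤ n → 1 ≤ N n) (x : ℝ) (n : ℕ) :
    cantorNum N (cantorDigit N x) n = ⌊(cantorProd N n : ℝ) * Int.fract x⌋₊ := by
  induction n with
  | zero =>
    have : ⌊Int.fract x⌋₊ = 0 := Nat.floor_eq_zero.2 (Int.fract_lt_one x)
    simp [cantorNum, cantorProd_zero, this]
  | succ n ih =>
    have h2 : (0 : ℝ) < N (n + 1) := by exact_mod_cast hN (n + 1) (by omega)
    have h3 : ⌊(cantorProd N n : ℝ) * Int.fract x⌋₊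
        = ⌊(cantorProd N (n + 1) : ℝ) * Int.fract x⌋₊ / N (n + 1) := by
      rw [← Nat.floor_div_natCast]
      congr 1
      rw [cantorProd_succ]
      push_cast
      field_simp
    rw [cantorNum, ih, cantorDigit, h3, mul_comm]
    exact Nat.div_add_mod _ _

/-- Passing to larger bases and shifted digits does not decrease differences of numerators. -/
theorem cantorNum_sub_le {P N a d e : ℕ → ℕ} (hNP : ∀ n, 1 ≤ n → N n ≤ P n)
    (hde : ∀ n, cantorNum N d n ≤ cantorNum N e n) (n : ℕ) :
    (cantorNum N e n : ℝ) - cantorNum N d n ≤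
      (cantorNum P (fun k => a k + e k) n : ℝ) - cantorNum P (fun k => a k + d k) n := by
  induction n with
  | zero => simp [cantorNum]
  | succ n ih =>
    have h1 : (N (n + 1) : ℝ) ≤ P (n + 1) := by exact_mod_cast hNP (n + 1) (by omega)
    have h2 : (cantorNum N d n : ℝ) ≤ cantorNum N e n := by exact_mod_cast hde n
    have h3 : (0 : ℝ) ≤ P (n + 1) := by positivity
    simp only [cantorNum]
    push_cast
    have h4 := mul_le_mul_of_nonneg_left h1 (sub_nonneg.2 h2)
    have h5 := mul_le_mul_of_nonneg_right ih h3
    nlinarith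

/-- The loss 2 has two sources: 1 from taking floors of `N`-numerators, and 1 from the length of the
`P`-cylinder containing the lower point. -/
theorem cantorProd_mul_sub_le {P N a : ℕ → ℕ} (hP : IsBasicSequence P)
    (hN : ∀ n, 1 ≤ n → 1 ≤ N n) (haN : ∀ n, 1 ≤ n → a n + N n ≤ P n) {u v : ℝ}
    (hu : u ∈ Ico (0 : ℝ) 1) (hv : v ∈ Ico (0 : ℝ) 1) (huv : u ≤ v) (n : ℕ) :
    (cantorProd N n : ℝ) * (v - u) - 2 ≤ cantorProd P n *
      (cantorVal P (fun k => a k + cantorDigit N v k) -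
        cantorVal P (fun k => a k + cantorDigit N u k)) := by
  have hfract : ∀ {z : ℝ}, z ∈ Ico (0 : ℝ) 1 → Int.fract z = z := fun hz =>
    Int.fract_eq_self.2 hz
  have hdig : ∀ z : ℝ, ∀ k, 1 ≤ k → a k + cantorDigit N z k < P k := fun z k hk => by
    have h1 : cantorDigit N z k < N k := Nat.mod_lt _ (hN k hk)
    have := haN k hk
    omega
  have hmono : ∀ k, cantorNum N (cantorDigit N u) k ≤ cantorNum N (cantorDigit N v) k := by
    intro k
    rw [cantorNum_cantorDigit hN, cantorNum_cantorDigit hN, hfract hu, hfract hv]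
    gcongr
  have h1 := cantorNum_sub_le (P := P) (a := a)
    (fun k hk => by have := haN k hk; omega) hmono n
  rw [cantorNum_cantorDigit hN, cantorNum_cantorDigit hN, hfract hu, hfract hv] at h1
  have h2 := Nat.lt_floor_add_one ((cantorProd N n : ℝ) * v)
  have h3 := Nat.floor_le (mul_nonneg (by positivity : (0 : ℝ) ≤ cantorProd N n) hu.1)
  have h4 := cantorNum_div_le_cantorVal hP (hdig v) n
  have h5 := cantorVal_le_cantorNum_div hP (hdig u) n
  have hp := cantorProd_pos hP n
  rw [div_le_iff₀ hp] at h4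
  rw [le_div_iff₀ hp] at h5
  linarith

/-- Hölder estimate for the inverse of the coding map of a homogeneous Cantor set. -/
theorem abs_sub_le_mul_rpow {P N a : ℕ → ℕ} (hP : IsBasicSequence P)
    (hN : ∀ n, 1 ≤ n → 1 ≤ N n) (haN : ∀ n, 1 ≤ n → a n + N n ≤ P n) {t c : ℝ} (ht : 0 < t)
    (hc : 0 < c) (h : ∀ n, c * (cantorProd P (n + 1) : ℝ) ^ t ≤ cantorProd N n) {u v : ℝ}
    (hu : u ∈ Ico (0 : ℝ) 1) (hv : v ∈ Ico (0 : ℝ) 1) :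
    |v - u| ≤ 3 / c * |cantorVal P (fun k => a k + cantorDigit N v k) -
        cantorVal P (fun k => a k + cantorDigit N u k)| ^ t := by
  wlog huv : u ≤ v generalizing u v
  · rw [abs_sub_comm, abs_sub_comm (cantorVal _ _)]
    exact this hv hu (le_of_not_ge huv)
  have hest := cantorProd_mul_sub_le hP hN haN hu hv huv
  have hdig : ∀ z : ℝ, ∀ k, 1 ≤ k → a k + cantorDigit N z k < P k := fun z k hk => by
    have h1 : cantorDigit N z k < N k := Nat.mod_lt _ (hN k hk)
    have := haN k hk
    omega
  have hv1 := cantorVal_le_cantorNum_div hP (hdig v) 0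
  have hu0 := cantorNum_div_le_cantorVal hP (hdig u) 0
  simp only [cantorNum, cantorProd_zero] at hv1 hu0
  set d := cantorVal P (fun k => a k + cantorDigit N v k) -
    cantorVal P (fun k => a k + cantorDigit N u k) with hd
  have hle : d ≤ 1 := by
    norm_num at hv1 hu0
    linarith
  rw [abs_of_nonneg (sub_nonneg.2 huv)]
  -- The sign of `d` is not yet known, so the positive part of `d` is used.
  refine le_trans ?_ (mul_le_mul_of_nonneg_left
    (Real.rpow_le_rpow (le_max_right d 0) (max_le (le_abs_self d) (abs_nonneg d)) ht.le)
      (by positivity))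
  -- If the images are within one cylinder length of order `n`, then `N_1 ⋯ N_n (v - u) ≤ 1 + 2`;
  -- this is the origin of the constant 3.
  have hscale : ∀ n, (cantorProd P n : ℝ) * d ≤ 1 →
      v - u ≤ 3 / c * (1 / (cantorProd P (n + 1) : ℝ)) ^ t := by
    intro n hn
    have hp := cantorProd_pos hP (n + 1)
    have h1 : (cantorProd N n : ℝ) * (v - u) ≤ 3 := by linarith [hest n]
    have h2 := (mul_le_mul_of_nonneg_right (h n) (sub_nonneg.2 huv)).trans h1
    have h3 : 0 < (cantorProd P (n + 1) : ℝ) ^ t := Real.rpow_pos_of_pos hp t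
    rw [Real.div_rpow zero_le_one hp.le, Real.one_rpow, div_mul_div_comm, mul_one,
      le_div_iff₀ (by positivity)]
    linarith
  rcases le_or_gt d 0 with h0 | h0
  · rw [max_eq_right h0, Real.zero_rpow ht.ne', mul_zero]
    have hT : Tendsto (fun n => 3 / c * (1 / (cantorProd P (n + 1) : ℝ)) ^ t) atTop (𝓝 0) := by
      have h1 := ((tendsto_inv_cantorProd hP).comp (tendsto_add_atTop_nat 1)).rpow_const
        (p := t) (Or.inr ht.le)
      simpa [Real.zero_rpow ht.ne'] using h1.const_mul (3 / c)
    refine ge_of_tendsto' hT fun n => hscale n ?_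
    have := cantorProd_pos hP n
    nlinarith
  · rw [max_eq_left h0.le]
    -- The first order at which `d` exceeds the cylinder length is some `n + 1`, since `d ≤ 1`. Then
    -- `hscale` applies at `n`, and `1 / (p_1 ⋯ p_{n+1}) < d`.
    have hex : ∃ n, 1 < (cantorProd P n : ℝ) * d := by
      obtain ⟨n, hn⟩ := (((tendsto_inv_cantorProd hP).eventually_lt_const h0)).exists
      refine ⟨n, ?_⟩
      rw [div_lt_iff₀ (cantorProd_pos hP n)] at hn
      linarith
    classical
    have hspec := Nat.find_spec hex
    have hmin := fun m => Nat.find_min (m := m) hex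
    obtain ⟨n, hn⟩ : ∃ n, Nat.find hex = n + 1 := by
      refine Nat.exists_eq_succ_of_ne_zero fun h0 => ?_
      rw [h0, cantorProd_zero] at hspec
      norm_num at hspec
      linarith
    rw [hn] at hspec hmin
    refine (hscale n (not_lt.1 (hmin n (by omega)))).trans ?_
    have hp := cantorProd_pos hP (n + 1)
    gcongr
    rw [div_le_iff₀ hp]
    linarith

/-- Lower bound for the dimension of a Cantor set given by blocks of consecutive digits. -/
theorem le_dimH_of_digits {P N a : ℕ → ℕ} (hP : IsBasicSequence P)
    (hN : ∀ n, 1 ≤ n → 1 ≤ N n) (haN : ∀ n, 1 ≤ n → a n + N n ≤ P n) {t c : ℝ} (ht : 0 < t)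
    (hc : 0 < c) (h : ∀ n, c * (cantorProd P (n + 1) : ℝ) ^ t ≤ cantorProd N n) {s : Set ℝ}
    (hs : ∀ e : ℕ → ℕ, (∀ n, 1 ≤ n → e n < N n) → cantorVal P (fun k => a k + e k) ∈ s) :
    ENNReal.ofReal t ≤ dimH s := by
  set g : ℝ → ℝ := fun u => cantorVal P (fun k => a k + cantorDigit N u k) with hg
  set I : Set ℝ := Ico (0 : ℝ) 1 with hI
  have hest : ∀ u ∈ I, ∀ v ∈ I, |v - u| ≤ 3 / c * |g v - g u| ^ t :=
    fun u hu v hv => abs_sub_le_mul_rpow hP hN haN ht hc h hu hv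
  have hinj : InjOn g I := by
    intro u hu v hv huv
    have := hest u hu v hv
    rw [huv, sub_self, abs_zero, Real.zero_rpow ht.ne', mul_zero] at this
    linarith [abs_eq_zero.1 (le_antisymm this (abs_nonneg _))]
  have hleft := hinj.leftInvOn_invFunOn
  have hHolder : HolderOnWith (Real.toNNReal (3 / c)) (Real.toNNReal t)
      (Function.invFunOn g I) (g '' I) := by
    rintro _ ⟨u, hu, rfl⟩ _ ⟨v, hv, rfl⟩
    rw [hleft hu, hleft hv, edist_dist, edist_dist, Real.coe_toNNReal _ ht.le,
      ENNReal.ofReal_rpow_of_nonneg dist_nonneg ht.le]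
    change _ ≤ ENNReal.ofReal (3 / c) * _
    rw [← ENNReal.ofReal_mul (by positivity), Real.dist_eq, Real.dist_eq]
    exact ENNReal.ofReal_le_ofReal (hest v hv u hu)
  -- The inverse of the coding map sends a subset of `s` onto `[0,1)` and is `t`-Hölder, so `1 ≤
  -- dimH / t`.
  have hdim := hHolder.dimH_image_le (Real.toNNReal_pos.2 ht)
  rw [hleft.image_image] at hdim
  have hI1 : dimH I = 1 := by
    rw [Real.dimH_of_nonempty_interior] <;> simp [hI]
  rw [hI1] at hdim
  have hsub : g '' I ⊆ s := by
    rintro _ ⟨u, -, rfl⟩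
    exact hs _ fun n hn => Nat.mod_lt _ (hN n hn)
  refine le_trans ?_ (dimH_mono hsub)
  have h0 : ENNReal.ofReal t ≠ 0 := by simpa using ht
  have := (ENNReal.le_div_iff_mul_le (Or.inl h0) (Or.inl ENNReal.ofReal_ne_top)).1 hdim
  rwa [one_mul] at this

/-! ### Upper bound for the dimension by cylinder covers. -/

/-- The numerators of the cylinders of order `n` whose digits lie in the sets `D k`. -/
def cantorNums (P : ℕ → ℕ) (D : ℕ → Finset ℕ) : ℕ → Finset ℕ
  | 0 => {0}
  | n + 1 => (cantorNums P D n ×ˢ D (n + 1)).image fun z => z.1 * P (n + 1) + z.2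

theorem card_cantorNums_le {P N : ℕ → ℕ} {D : ℕ → Finset ℕ}
    (hN : ∀ n, 1 ≤ n → (D n).card ≤ N n) (n : ℕ) :
    (cantorNums P D n).card ≤ cantorProd N n := by
  induction n with
  | zero => simp [cantorNums, cantorProd_zero]
  | succ n ih =>
    rw [cantorNums, cantorProd_succ]
    refine Finset.card_image_le.trans ?_
    rw [Finset.card_product]
    exact Nat.mul_le_mul ih (hN _ (by omega))

theorem cantorNum_mem_cantorNums {P E : ℕ → ℕ} {D : ℕ → Finset ℕ}
    (hE : ∀ n, 1 ≤ n → E n ∈ D n) (n : ℕ) : cantorNum P E n ∈ cantorNums P D n := by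
  induction n with
  | zero => simp [cantorNums, cantorNum]
  | succ n ih =>
    rw [cantorNums, cantorNum]
    exact Finset.mem_image.2 ⟨(_, _), Finset.mem_product.2 ⟨ih, hE _ (by omega)⟩, rfl⟩

/-- Upper bound for the dimension of a set whose digits are restricted. -/
theorem dimH_le_of_digits {P N : ℕ → ℕ} {D : ℕ → Finset ℕ} (hP : IsBasicSequence P)
    (hN : ∀ n, 1 ≤ n → (D n).card ≤ N n) {t C : ℝ} (ht : 0 ≤ t)
    (h : ∀ᶠ n in atTop, (cantorProd N n : ℝ) ≤ C * (cantorProd P n : ℝ) ^ t) {s : Set ℝ}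
    (hs : ∀ x ∈ s, x ∈ Ico (0 : ℝ) 1 ∧ ∀ n, 1 ≤ n → cantorDigit P x n ∈ D n) :
    dimH s ≤ ENNReal.ofReal t := by
  have hcov : ∀ n, s ⊆ ⋃ i : cantorNums P D n,
      Icc ((i : ℝ) / cantorProd P n) (((i : ℝ) + 1) / cantorProd P n) := by
    intro n x hx
    have hp := cantorProd_pos hP n
    have h1 := cantorNum_digit hP x n
    rw [Int.fract_eq_self.2 (hs x hx).1] at h1
    refine mem_iUnion.2 ⟨⟨_, cantorNum_mem_cantorNums (hs x hx).2 n⟩, ?_⟩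
    simp only [h1]
    constructor
    · rw [div_le_iff₀ hp, mul_comm x]
      exact Nat.floor_le (mul_nonneg hp.le (hs x hx).1.1)
    · rw [le_div_iff₀ hp, mul_comm x]
      exact (Nat.lt_floor_add_one _).le
  have hdiam : ∀ n, ∀ i : cantorNums P D n,
      Metric.ediam (Icc ((i : ℝ) / cantorProd P n) (((i : ℝ) + 1) / cantorProd P n))
        = ENNReal.ofReal (1 / cantorProd P n) := by
    intro n i
    rw [Real.ediam_Icc]
    congr 1
    ring
  have key := MeasureTheory.Measure.hausdorffMeasure_le_liminf_sum (l := atTop) t s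
    (fun n => ENNReal.ofReal (1 / cantorProd P n))
    (by simpa using ENNReal.tendsto_ofReal (tendsto_inv_cantorProd hP)) _
    (Eventually.of_forall fun n i => (hdiam n i).le) (Eventually.of_forall hcov)
  have hbound : ∀ᶠ n in atTop, ∑ i : cantorNums P D n,
      Metric.ediam (Icc ((i : ℝ) / cantorProd P n) (((i : ℝ) + 1) / cantorProd P n)) ^ t
        ≤ ENNReal.ofReal C := by
    filter_upwards [h] with n hn
    have hp := cantorProd_pos hP n
    simp only [hdiam]
    rw [Finset.sum_const, Finset.card_univ, Fintype.card_coe, nsmul_eq_mul,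
      ENNReal.ofReal_rpow_of_nonneg (by positivity) ht, ← ENNReal.ofReal_natCast,
      ← ENNReal.ofReal_mul (by positivity)]
    apply ENNReal.ofReal_le_ofReal
    have h1 : ((cantorNums P D n).card : ℝ) ≤ cantorProd N n := by
      exact_mod_cast card_cantorNums_le hN n
    rw [Real.div_rpow zero_le_one hp.le, Real.one_rpow, mul_one_div,
      div_le_iff₀ (Real.rpow_pos_of_pos hp t)]
    exact h1.trans hn
  have hfin : MeasureTheory.Measure.hausdorffMeasure t s ≠ ⊤ := by
    refine ne_top_of_le_ne_top (ENNReal.ofReal_ne_top (r := C)) (key.trans ?_)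
    exact liminf_le_of_frequently_le' hbound.frequently
  have h2 : ((Real.toNNReal t : NNReal) : ℝ) = t := Real.coe_toNNReal _ ht
  rw [← h2] at hfin
  exact dimH_le_of_hausdorffMeasure_ne_top hfin

/-! ### Nice growth and partial sums of logarithms. -/

theorem triangular_succ (m : ℕ) : triangular (m + 1) = triangular m + (m + 1) := by
  unfold triangular
  rw [show (m + 1) * (m + 1 + 1) = m * (m + 1) + 2 * (m + 1) by ring,
    Nat.add_mul_div_left _ _ (by norm_num)]

theorem le_triangular (m : ℕ) : m ≤ triangular m := by
  induction m with
  | zero => simp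
  | succ m ih => rw [triangular_succ]; omega

theorem exists_triangular_le_lt (K n : ℕ) (hn : triangular (K + 1) ≤ n) :
    ∃ m, K ≤ m ∧ triangular (m + 1) ≤ n ∧ n < triangular (m + 2) := by
  induction n, hn using Nat.le_induction with
  | base => exact ⟨K, le_rfl, le_rfl, by rw [triangular_succ (K + 1)]; omega⟩
  | succ n _ ih =>
    obtain ⟨m, h1, h2, h3⟩ := ih
    rcases Nat.lt_or_ge (n + 1) (triangular (m + 2)) with h | h
    · exact ⟨m, h1, by omega, h⟩
    · exact ⟨m + 1, by omega, h, by rw [triangular_succ (m + 2)]; omega⟩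

/-- The logarithms of a nicely growing sequence are negligible against their partial sums. -/
theorem GrowsNicely.tendsto_log_div_sum {s : ℕ → ℝ} (hs : GrowsNicely s)
    (hs1 : ∀ n, 1 ≤ n → 1 ≤ s n) :
    Tendsto (fun n => Real.log (s (n + 1)) / ∑ k ∈ Finset.range n, Real.log (s (k + 1)))
      atTop (𝓝 0) := by
  obtain ⟨⟨N, hmono⟩, hinf, hrat⟩ := hs
  have hnonneg : ∀ n, 0 ≤ Real.log (s (n + 1)) := fun n =>
    Real.log_nonneg (hs1 _ (by omega))
  have htri : Tendsto triangular atTop atTop := tendsto_atTop_mono le_triangular tendsto_id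
  have hev : ∀ᶠ m in atTop, 0 < Real.log (s (triangular m)) ∧
      Real.log (s (triangular (m + 2))) ≤ 2 * Real.log (s (triangular m)) := by
    filter_upwards [(hinf.comp htri).eventually_gt_atTop 1,
      hrat.eventually_lt_const (show (1 : ℝ) < 2 by norm_num)] with m h1 h2
    have h3 : 0 < Real.log (s (triangular m)) := Real.log_pos h1
    exact ⟨h3, ((div_lt_iff₀ h3).1 h2).le⟩
  obtain ⟨M, hM⟩ := eventually_atTop.1 hev
  rw [Metric.tendsto_atTop]
  intro ε hε
  obtain ⟨K, hK⟩ := exists_nat_gt (2 / ε)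
  -- `M` secures the ratio bound 2, `N` monotonicity, and `K > 2 / ε` the length of the block.
  refine ⟨triangular (K + M + N + 2), fun n hn => ?_⟩
  obtain ⟨m, hm1, hm2, hm3⟩ := exists_triangular_le_lt (K + M + N + 1) n hn
  obtain ⟨hpos, htwo⟩ := hM m (by omega)
  have hmτ := le_triangular m
  have hlogmono : ∀ i j, triangular m ≤ i → i ≤ j → Real.log (s i) ≤ Real.log (s j) :=
    fun i j hi hij => Real.log_le_log (by linarith [hs1 i (by omega)])
      (hmono i j (by omega) hij)
  have hτ := triangular_succ m
  -- The `m + 1` indices between `τ_m` and `τ_{m+1}` each contribute at least `log s_{τ_m}`, whereas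
  -- `log s_{n+1}` is at most twice that because `n + 1 ≤ τ_{m+2}`.
  have hsum : (m + 1 : ℝ) * Real.log (s (triangular m)) ≤
      ∑ k ∈ Finset.range n, Real.log (s (k + 1)) := by
    calc (m + 1 : ℝ) * Real.log (s (triangular m))
        = ∑ k ∈ Finset.Ico (triangular m) (triangular (m + 1)),
            Real.log (s (triangular m)) := by
          rw [Finset.sum_const, Nat.card_Ico, nsmul_eq_mul, hτ, Nat.add_sub_cancel_left]
          push_cast
          ring
      _ ≤ ∑ k ∈ Finset.Ico (triangular m) (triangular (m + 1)), Real.log (s (k + 1)) :=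
          Finset.sum_le_sum fun k hk =>
            hlogmono _ _ le_rfl (by have := (Finset.mem_Ico.1 hk).1; omega)
      _ ≤ _ := Finset.sum_le_sum_of_subset_of_nonneg (fun k hk => by
            have := (Finset.mem_Ico.1 hk).2
            exact Finset.mem_range.2 (by omega)) fun k _ _ => hnonneg k
  have hn1 : Real.log (s (n + 1)) ≤ 2 * Real.log (s (triangular m)) :=
    (hlogmono _ _ (by omega) (by omega)).trans htwo
  have hSpos : 0 < ∑ k ∈ Finset.range n, Real.log (s (k + 1)) := by
    refine lt_of_lt_of_le ?_ hsum
    positivity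
  rw [Real.dist_eq, sub_zero, abs_of_nonneg (div_nonneg (hnonneg n) hSpos.le),
    div_lt_iff₀ hSpos]
  have h1 : (K : ℝ) ≤ m := by exact_mod_cast (by omega : K ≤ m)
  rw [div_lt_iff₀ hε] at hK
  have h2 : 2 < ε * (m + 1) := by nlinarith
  calc Real.log (s (n + 1)) ≤ 2 * Real.log (s (triangular m)) := hn1
    _ < ε * (m + 1) * Real.log (s (triangular m)) := by gcongr
    _ = ε * ((m + 1) * Real.log (s (triangular m))) := by ring
    _ ≤ _ := by gcongr

/-! ### Weighted averages along a set of given density. -/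

/-- Summation by parts with bounded partial sums against an eventually monotone sequence. -/
theorem abs_sum_mul_sub_le {c b : ℕ → ℝ} (hc : ∀ n, |∑ k ∈ Finset.range n, c k| ≤ 1) {N : ℕ}
    (hb : ∀ n, N ≤ n → b n ≤ b (n + 1)) (n : ℕ) (hn : N ≤ n) :
    |∑ k ∈ Finset.range n, c k * b k - (∑ k ∈ Finset.range n, c k) * b n| ≤
      b n - b N +
        |∑ k ∈ Finset.range N, c k * b k - (∑ k ∈ Finset.range N, c k) * b N| := by
  induction n, hn using Nat.le_induction with
  | base => simp
  | succ n hn ih =>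
    have h1 : ∑ k ∈ Finset.range (n + 1), c k * b k -
        (∑ k ∈ Finset.range (n + 1), c k) * b (n + 1)
        = (∑ k ∈ Finset.range n, c k * b k - (∑ k ∈ Finset.range n, c k) * b n) -
          (∑ k ∈ Finset.range (n + 1), c k) * (b (n + 1) - b n) := by
      simp only [Finset.sum_range_succ]
      ring
    have h2 : |(∑ k ∈ Finset.range (n + 1), c k) * (b (n + 1) - b n)| ≤ b (n + 1) - b n := by
      have h3 := sub_nonneg.2 (hb n hn)
      rw [abs_mul, abs_of_nonneg h3]
      exact mul_le_of_le_one_left h3 (hc _)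
    rw [h1]
    refine (abs_sub _ _).trans ?_
    linarith

/-- Split `θ l = θ (l - σ b) + σ (θ - ρ) b + σ ρ b`. The first part sums to `o(B)` by `hl`, and
summation by parts bounds the sum of `(θ - ρ) b` by `2 b n + C`, which is `o(B)` by `hslow`. -/
theorem tendsto_weighted_sum_div {b l θ : ℕ → ℝ} {ρ σ : ℝ} (hb0 : 0 ≤ b) {N : ℕ}
    (hb : ∀ n, N ≤ n → b n ≤ b (n + 1))
    (hB : Tendsto (fun n => ∑ k ∈ Finset.range n, b k) atTop atTop)
    (hslow : Tendsto (fun n => b n / ∑ k ∈ Finset.range n, b k) atTop (𝓝 0))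
    (hθ : ∀ n, |θ n| ≤ 1) (hc : ∀ n, |∑ k ∈ Finset.range n, (θ k - ρ)| ≤ 1)
    (hl : (fun n => l n - σ * b n) =o[atTop] b) :
    Tendsto (fun n => (∑ k ∈ Finset.range n, θ k * l k) / ∑ k ∈ Finset.range n, b k) atTop
      (𝓝 (σ * ρ)) := by
  set B : ℕ → ℝ := fun n => ∑ k ∈ Finset.range n, b k with hBdef
  have hBne : ∀ᶠ n in atTop, B n ≠ 0 := hB.eventually_ne_atTop 0
  have hbB : b =o[atTop] B :=
    (Asymptotics.isLittleO_iff_tendsto' (hBne.mono fun n h h0 => absurd h0 h)).2 hslow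
  have hone : ∀ C : ℝ, (fun _ : ℕ => C) =o[atTop] B := fun C =>
    Asymptotics.isLittleO_const_left.2 (Or.inr (tendsto_norm_atTop_atTop.comp hB))
  have h1 : (fun n => ∑ k ∈ Finset.range n, θ k * (l k - σ * b k)) =o[atTop] B := by
    refine Asymptotics.IsLittleO.sum_range (Asymptotics.IsBigO.trans_isLittleO ?_ hl) hb0 hB
    refine Asymptotics.IsBigO.of_bound 1 (Eventually.of_forall fun n => ?_)
    rw [norm_mul]
    exact mul_le_mul_of_nonneg_right (hθ n) (norm_nonneg _)
  have h2 : (fun n => ∑ k ∈ Finset.range n, (θ k - ρ) * b k) =o[atTop] B := by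
    set C := |∑ k ∈ Finset.range N, (θ k - ρ) * b k -
      (∑ k ∈ Finset.range N, (θ k - ρ)) * b N|
    refine Asymptotics.IsBigO.trans_isLittleO (g := fun n => 2 * b n + C) ?_
      ((hbB.const_mul_left 2).add (hone C))
    refine Asymptotics.IsBigO.of_bound 1 ?_
    filter_upwards [eventually_ge_atTop N] with n hn
    have h3 := abs_sum_mul_sub_le (c := fun k => θ k - ρ) hc hb n hn
    have h4 : |(∑ k ∈ Finset.range n, (θ k - ρ)) * b n| ≤ b n := by
      rw [abs_mul, abs_of_nonneg (hb0 n)]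
      exact mul_le_of_le_one_left (hb0 n) (hc n)
    have h5 := abs_sub_abs_le_abs_sub (∑ k ∈ Finset.range n, (θ k - ρ) * b k)
      ((∑ k ∈ Finset.range n, (θ k - ρ)) * b n)
    have h6 : 0 ≤ b N := hb0 N
    rw [one_mul, Real.norm_eq_abs, Real.norm_eq_abs]
    refine le_trans ?_ (le_abs_self _)
    linarith
  have h3 := (h1.add (h2.const_mul_left σ)).tendsto_div_nhds_zero
  have h4 := h3.add_const (σ * ρ)
  rw [zero_add] at h4
  refine h4.congr' ?_
  filter_upwards [hBne] with n hn
  have h5 : ∑ k ∈ Finset.range n, θ k * l k =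
      ∑ k ∈ Finset.range n, θ k * (l k - σ * b k) +
        σ * ∑ k ∈ Finset.range n, (θ k - ρ) * b k + σ * ρ * B n := by
    rw [hBdef, Finset.mul_sum, Finset.mul_sum, ← Finset.sum_add_distrib,
      ← Finset.sum_add_distrib]
    exact Finset.sum_congr rfl fun k _ => by ring
  rw [h5, show (∑ k ∈ Finset.range n, b k) = B n from rfl, add_div _ (σ * ρ * B n),
    mul_div_assoc (σ * ρ) (B n), div_self hn, mul_one]

/-- One further term multiplies the denominator by `1 + o(1)`. The lower dimension bound needs this,
since it compares `N_1 ⋯ N_n` with `p_1 ⋯ p_{n+1}`. -/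
theorem tendsto_div_sum_succ {b L : ℕ → ℝ} {a : ℝ}
    (hB : Tendsto (fun n => ∑ k ∈ Finset.range n, b k) atTop atTop)
    (hslow : Tendsto (fun n => b n / ∑ k ∈ Finset.range n, b k) atTop (𝓝 0))
    (h : Tendsto (fun n => L n / ∑ k ∈ Finset.range n, b k) atTop (𝓝 a)) :
    Tendsto (fun n => L n / ∑ k ∈ Finset.range (n + 1), b k) atTop (𝓝 a) := by
  have h1 := h.div (hslow.const_add 1) (by norm_num)
  rw [add_zero, div_one] at h1
  refine h1.congr' ?_
  filter_upwards [hB.eventually_ne_atTop 0] with n hn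
  rw [Pi.div_apply, Finset.sum_range_succ]
  field_simp

/-! ### An index set of density `ρ` with bounded discrepancy. -/

/-- The set of `n` at which `⌊ρ n⌋` jumps; for `ρ ∈ [0,1]` it has density `ρ`. -/
def jumpSet (ρ : ℝ) : Set ℕ := {n | ⌊ρ * ((n : ℝ) - 1)⌋ < ⌊ρ * (n : ℝ)⌋}

-- For `ρ ∈ [0,1]` each jump is 0 or 1, so the indicator is the increment of the floor and its sums
-- telescope.
open Classical in
theorem ite_mem_jumpSet {ρ : ℝ} (hρ : ρ ∈ Icc (0 : ℝ) 1) (k : ℕ) :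
    (if k + 1 ∈ jumpSet ρ then (1 : ℝ) else 0) = (⌊ρ * ((k + 1 : ℕ) : ℝ)⌋ : ℝ) - ⌊ρ * (k : ℝ)⌋ := by
  have h1 : ⌊ρ * (k : ℝ)⌋ ≤ ⌊ρ * ((k + 1 : ℕ) : ℝ)⌋ := by
    have := hρ.1
    gcongr
    omega
  have h2 : ⌊ρ * ((k + 1 : ℕ) : ℝ)⌋ ≤ ⌊ρ * (k : ℝ)⌋ + 1 := by
    rw [← Int.floor_add_one]
    have := hρ.2
    apply Int.floor_le_floor
    push_cast
    linarith
  have h3 : k + 1 ∈ jumpSet ρ ↔ ⌊ρ * (k : ℝ)⌋ < ⌊ρ * ((k + 1 : ℕ) : ℝ)⌋ := by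
    simp [jumpSet]
  split_ifs with h
  · have : ⌊ρ * ((k + 1 : ℕ) : ℝ)⌋ = ⌊ρ * (k : ℝ)⌋ + 1 := by have := h3.1 h; omega
    rw [this]
    push_cast
    ring
  · have : ⌊ρ * ((k + 1 : ℕ) : ℝ)⌋ = ⌊ρ * (k : ℝ)⌋ := by have := mt h3.2 h; omega
    rw [this, sub_self]

open Classical in
theorem sum_ite_mem_jumpSet {ρ : ℝ} (hρ : ρ ∈ Icc (0 : ℝ) 1) (n : ℕ) :
    ∑ k ∈ Finset.range n, (if k + 1 ∈ jumpSet ρ then (1 : ℝ) else 0) = ⌊ρ * (n : ℝ)⌋ := by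
  simp only [ite_mem_jumpSet hρ]
  rw [Finset.sum_range_sub (fun k : ℕ => (⌊ρ * (k : ℝ)⌋ : ℝ))]
  simp

open Classical in
theorem abs_sum_jumpSet_sub_le {ρ : ℝ} (hρ : ρ ∈ Icc (0 : ℝ) 1) (n : ℕ) :
    |∑ k ∈ Finset.range n, ((if k + 1 ∈ jumpSet ρ then (1 : ℝ) else 0) - ρ)| ≤ 1 := by
  rw [Finset.sum_sub_distrib, sum_ite_mem_jumpSet hρ, Finset.sum_const, Finset.card_range,
    nsmul_eq_mul, abs_le]
  have h1 := Int.floor_le (ρ * (n : ℝ))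
  have h2 := Int.lt_floor_add_one (ρ * (n : ℝ))
  constructor <;> linarith

/-- Otherwise the floor of `ρ n` would eventually grow with slope `1 > ρ`. -/
theorem exists_notMem_jumpSet {ρ : ℝ} (hρ : ρ ∈ Ico (0 : ℝ) 1) (N : ℕ) :
    ∃ n, N ≤ n ∧ 1 ≤ n ∧ n ∉ jumpSet ρ := by
  by_contra! hcon
  classical
  have hρ' : ρ ∈ Icc (0 : ℝ) 1 := ⟨hρ.1, hρ.2.le⟩
  have h1 : ∀ k : ℕ, (⌊ρ * ((N + k : ℕ) : ℝ)⌋ : ℝ) = ⌊ρ * (N : ℝ)⌋ + k := by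
    intro k
    induction k with
    | zero => simp
    | succ k ih =>
      have h2 := ite_mem_jumpSet hρ' (N + k)
      rw [if_pos (hcon _ (by omega) (by omega)), ih] at h2
      rw [← add_assoc]
      push_cast at h2 ⊢
      linarith
  obtain ⟨k, hk⟩ := exists_nat_gt (1 / (1 - ρ))
  rw [div_lt_iff₀ (by linarith [hρ.2])] at hk
  have h2 := h1 k
  have h3 := Int.floor_le (ρ * ((N + k : ℕ) : ℝ))
  have h4 := Int.lt_floor_add_one (ρ * (N : ℝ))
  push_cast at h2 h3
  linarith

/-! ### From logarithmic asymptotics to dimensions. -/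

theorem log_cantorProd {P : ℕ → ℕ} (hP : ∀ n, 1 ≤ n → 1 ≤ P n) (n : ℕ) :
    Real.log (cantorProd P n) = ∑ k ∈ Finset.range n, Real.log (P (k + 1)) := by
  induction n with
  | zero => simp [cantorProd_zero]
  | succ n ih =>
    have h1 := cantorProd_pos_of_one_le hP n
    have h2 := hP (n + 1) (by omega)
    rw [Finset.sum_range_succ, ← ih, cantorProd_succ, Nat.cast_mul,
      Real.log_mul (by positivity) (by positivity)]

/-- The finitely many exceptional indices are absorbed into `c`, one at a time going down from `N`.
-/
theorem exists_pos_mul_le_of_eventually_le {f g : ℕ → ℝ} (hf : ∀ n, 0 < f n) (hg : ∀ n, 0 < g n)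
    (h : ∀ᶠ n in atTop, f n ≤ g n) : ∃ c > 0, ∀ n, c * f n ≤ g n := by
  obtain ⟨N, hN⟩ := eventually_atTop.1 h
  have key : ∀ M ≤ N, ∃ c > 0, ∀ n, N - M ≤ n → c * f n ≤ g n := by
    intro M
    induction M with
    | zero => exact fun _ => ⟨1, one_pos, fun n hn => by simpa using hN n hn⟩
    | succ M ih =>
      intro hM
      obtain ⟨c, hc, hcn⟩ := ih (by omega)
      refine ⟨min c (g (N - (M + 1)) / f (N - (M + 1))),
        lt_min hc (div_pos (hg _) (hf _)), fun n hn => ?_⟩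
      rcases hn.eq_or_lt with rfl | hlt
      · exact (le_div_iff₀ (hf _)).1 (min_le_right _ _)
      · exact (mul_le_mul_of_nonneg_right (min_le_left _ _) (hf n).le).trans
          (hcn n (by omega))
  obtain ⟨c, hc, hcn⟩ := key N le_rfl
  exact ⟨c, hc, fun n => hcn n (by omega)⟩

theorem one_lt_cantorProd_succ {P : ℕ → ℕ} (hP : IsBasicSequence P) (n : ℕ) :
    (1 : ℝ) < cantorProd P (n + 1) := by
  have h1 := two_pow_le_cantorProd hP (n + 1)
  have h2 : 2 ^ 1 ≤ 2 ^ (n + 1) := Nat.pow_le_pow_right (by norm_num) (by omega)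
  exact_mod_cast (by omega : 1 < cantorProd P (n + 1))

theorem ofReal_le_dimH_of_tendsto {P N a : ℕ → ℕ} (hP : IsBasicSequence P)
    (hN : ∀ n, 1 ≤ n → 1 ≤ N n) (haN : ∀ n, 1 ≤ n → a n + N n ≤ P n) {α : ℝ}
    (h : Tendsto (fun n => Real.log (cantorProd N n) / Real.log (cantorProd P (n + 1))) atTop
      (𝓝 α)) {s : Set ℝ}
    (hs : ∀ e : ℕ → ℕ, (∀ n, 1 ≤ n → e n < N n) → cantorVal P (fun k => a k + e k) ∈ s) :
    ENNReal.ofReal α ≤ dimH s := by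
  by_contra! hcon
  obtain ⟨t, -, h1, h2⟩ := ENNReal.lt_iff_exists_real_btwn.1 hcon
  have ht : 0 < t := ENNReal.ofReal_pos.1 (lt_of_le_of_lt zero_le h1)
  have htα : t < α := (ENNReal.ofReal_lt_ofReal_iff_of_nonneg ht.le).1 h2
  have hMpos : ∀ n, (0 : ℝ) < cantorProd N n := fun n => by
    exact_mod_cast cantorProd_pos_of_one_le hN n
  obtain ⟨c, hc, hcn⟩ := exists_pos_mul_le_of_eventually_le
    (f := fun n => (cantorProd P (n + 1) : ℝ) ^ t) (g := fun n => (cantorProd N n : ℝ))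
    (fun n => Real.rpow_pos_of_pos (cantorProd_pos hP _) t) hMpos (by
      filter_upwards [h.eventually_const_lt htα] with n hn
      rw [lt_div_iff₀ (Real.log_pos (one_lt_cantorProd_succ hP n))] at hn
      exact (Real.le_log_iff_exp_le (hMpos n)).1 hn.le |>.trans' (by
        rw [mul_comm, Real.rpow_def_of_pos (cantorProd_pos hP _)]))
  exact absurd (le_dimH_of_digits hP hN haN ht hc hcn hs) (not_le.2 h1)

theorem dimH_le_ofReal_of_tendsto {P N : ℕ → ℕ} {D : ℕ → Finset ℕ} (hP : IsBasicSequence P)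
    (hN : ∀ n, 1 ≤ n → 1 ≤ N n) (hD : ∀ n, 1 ≤ n → (D n).card ≤ N n) {α : ℝ}
    (h : Tendsto (fun n => Real.log (cantorProd N n) / Real.log (cantorProd P n)) atTop
      (𝓝 α)) {s : Set ℝ}
    (hs : ∀ x ∈ s, x ∈ Ico (0 : ℝ) 1 ∧ ∀ n, 1 ≤ n → cantorDigit P x n ∈ D n) :
    dimH s ≤ ENNReal.ofReal α := by
  by_contra! hcon
  obtain ⟨t, ht, h1, h2⟩ := ENNReal.lt_iff_exists_real_btwn.1 hcon
  have htα : α < t := (ENNReal.ofReal_lt_ofReal_iff').1 h1 |>.1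
  refine absurd (dimH_le_of_digits hP hD ht (C := 1) ?_ hs) (not_le.2 h2)
  filter_upwards [h.eventually_lt_const htα, eventually_ge_atTop 1] with n hn hn1
  obtain ⟨k, rfl⟩ : ∃ k, n = k + 1 := ⟨n - 1, by omega⟩
  rw [div_lt_iff₀ (Real.log_pos (one_lt_cantorProd_succ hP k))] at hn
  rw [one_mul, Real.rpow_def_of_pos (cantorProd_pos hP _), mul_comm]
  exact (Real.log_le_iff_le_exp (by exact_mod_cast cantorProd_pos_of_one_le hN _)).1 hn.le

/-- Logarithmic size of a product of bases supported on a set of indices of density `ρ`. -/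
theorem tendsto_log_cantorProd_div {P N : ℕ → ℕ} (hP : IsBasicSequence P)
    (hPnice : GrowsNicely (fun n => (P n : ℝ))) (hN : ∀ n, 1 ≤ n → 1 ≤ N n) {l θ : ℕ → ℝ}
    {ρ σ : ℝ} (hθ : ∀ n, |θ n| ≤ 1) (hc : ∀ n, |∑ k ∈ Finset.range n, (θ k - ρ)| ≤ 1)
    (hNl : ∀ k, Real.log (N (k + 1)) = θ k * l (k + 1))
    (hl : Tendsto (fun n => l n / Real.log (P n)) atTop (𝓝 σ)) :
    Tendsto (fun n => Real.log (cantorProd N n) / Real.log (cantorProd P n)) atTop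
        (𝓝 (σ * ρ)) ∧
      Tendsto (fun n => Real.log (cantorProd N n) / Real.log (cantorProd P (n + 1))) atTop
        (𝓝 (σ * ρ)) := by
  have hP1 : ∀ n, 1 ≤ n → 1 ≤ P n := fun n hn => (by norm_num : 1 ≤ 2).trans (hP n hn)
  have hP1' : ∀ n, 1 ≤ n → (1 : ℝ) ≤ P n := fun n hn => by exact_mod_cast hP1 n hn
  simp only [log_cantorProd hP1, log_cantorProd hN, hNl]
  have hslow := hPnice.tendsto_log_div_sum hP1'
  obtain ⟨M, hM⟩ := hPnice.1
  have hB : Tendsto (fun n => ∑ k ∈ Finset.range n, Real.log (P (k + 1))) atTop atTop := by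
    refine tendsto_atTop_mono (fun n => ?_)
      (tendsto_natCast_atTop_atTop.atTop_mul_const (Real.log_pos (by norm_num : (1 : ℝ) < 2)))
    calc (n : ℝ) * Real.log 2 = ∑ k ∈ Finset.range n, Real.log 2 := by simp
      _ ≤ _ := Finset.sum_le_sum fun k _ =>
        Real.log_le_log (by norm_num) (by exact_mod_cast hP (k + 1) (by omega))
  have hpos : ∀ k, 0 < Real.log (P (k + 1)) := fun k =>
    Real.log_pos (by exact_mod_cast hP (k + 1) (by omega))
  have h1 := tendsto_weighted_sum_div (b := fun k => Real.log (P (k + 1)))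
    (l := fun k => l (k + 1)) (θ := θ) (ρ := ρ) (σ := σ) (N := M)
    (fun k => (hpos k).le)
    (fun n hn => Real.log_le_log (by linarith [hP1' (n + 1) (by omega)])
      (hM _ _ (by omega) (by omega))) hB hslow hθ hc (by
      rw [Asymptotics.isLittleO_iff_tendsto fun k hk => absurd hk (hpos k).ne']
      have h2 := (hl.comp (tendsto_add_atTop_nat 1)).sub_const σ
      rw [sub_self] at h2
      refine h2.congr fun k => ?_
      have := (hpos k).ne'
      simp only [Function.comp]
      field_simp)
  exact ⟨h1, tendsto_div_sum_succ hB hslow h1⟩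

/-- A bounded factor shifts logarithms by `log c`, negligible against `log p`. This replaces `r_n +
1` by `r_n` and `max (q_n - 2) 1` by `q_n`. -/
theorem tendsto_log_div_of_le_of_le {f g p : ℕ → ℝ} {σ c : ℝ} (hp : Tendsto p atTop atTop)
    (hf : Tendsto (fun n => Real.log (f n) / Real.log (p n)) atTop (𝓝 σ)) (hc : 0 < c)
    (hfpos : ∀ᶠ n in atTop, 0 < f n) (hgpos : ∀ᶠ n in atTop, 0 < g n)
    (h1 : ∀ᶠ n in atTop, f n ≤ c * g n) (h2 : ∀ᶠ n in atTop, g n ≤ c * f n) :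
    Tendsto (fun n => Real.log (g n) / Real.log (p n)) atTop (𝓝 σ) := by
  have hlogp : Tendsto (fun n => Real.log (p n)) atTop atTop := Real.tendsto_log_atTop.comp hp
  have h0 : Tendsto (fun n => Real.log c / Real.log (p n)) atTop (𝓝 0) :=
    hlogp.const_div_atTop (Real.log c)
  have hlow := hf.sub h0
  have hup := hf.add h0
  rw [sub_zero] at hlow
  rw [add_zero] at hup
  refine tendsto_of_tendsto_of_tendsto_of_le_of_le' hlow hup ?_ ?_
  · filter_upwards [hlogp.eventually_gt_atTop 0, hfpos, hgpos, h1] with n hn hf hg h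
    rw [← sub_div]
    gcongr
    have := Real.log_le_log hf h
    rw [Real.log_mul hc.ne' hg.ne'] at this
    linarith
  · filter_upwards [hlogp.eventually_gt_atTop 0, hfpos, hgpos, h2] with n hn hf hg h
    rw [← add_div]
    gcongr
    have := Real.log_le_log hg h
    rw [Real.log_mul hc.ne' hf.ne'] at this
    linarith

/-! ### The level sets and their dimension. -/

/-- `psi` in terms of natural-number digits. -/
theorem psi_eq_cantorVal (P : ℕ → ℕ) {Q : ℕ → ℕ} (hQ : IsBasicSequence Q) (x : ℝ) :
    psi P Q x = cantorVal Q (fun n => min (cantorDigit P x n) (Q n - 1)) := by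
  unfold psi cantorVal
  refine tsum_congr fun n => ?_
  have := hQ (n + 1) (by omega)
  rw [Nat.cast_min, Nat.cast_sub (by omega), Nat.cast_one]

/-- The bases of the level sets: `r_n + 1` digits on `S`, a single digit off `S`. -/
noncomputable def levelBase (P Q : ℕ → ℕ) (S : Set ℕ) (n : ℕ) : ℕ :=
  open Classical in if n ∈ S then P n - Q n + 1 else 1

/-- The digit sequences of the level sets that are considered: maximal exactly on `S`, and not
eventually zero. -/
structure IsLevelDigits (Q : ℕ → ℕ) (S : Set ℕ) (F : ℕ → ℕ) : Prop where
  eq_of_mem : ∀ n, 1 ≤ n → n ∈ S → F n = Q n - 1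
  lt_of_notMem : ∀ n, 1 ≤ n → n ∉ S → F n < Q n - 1
  frequently_ne_zero : ∀ N, ∃ n, N ≤ n ∧ 1 ≤ n ∧ F n ≠ 0

theorem IsLevelDigits.lt {Q F : ℕ → ℕ} {S : Set ℕ} (hQ : IsBasicSequence Q)
    (hF : IsLevelDigits Q S F) (n : ℕ) (hn : 1 ≤ n) : F n < Q n := by
  have := hQ n hn
  by_cases h : n ∈ S
  · have := hF.eq_of_mem n hn h
    omega
  · have := hF.lt_of_notMem n hn h
    omega

theorem IsLevelDigits.mem_levelSet {P Q F e : ℕ → ℕ} {S : Set ℕ} (hP : IsBasicSequence P)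
    (hQ : IsBasicSequence Q) (hPQ : ∀ n, 1 ≤ n → Q n < P n)
    (hS : ∀ N, ∃ n, N ≤ n ∧ 1 ≤ n ∧ n ∉ S) (hF : IsLevelDigits Q S F)
    (he : ∀ n, 1 ≤ n → e n < levelBase P Q S n) :
    cantorVal P (fun n => F n + e n) ∈ levelSet P Q (cantorVal Q F) := by
  have hmem : ∀ n, 1 ≤ n → n ∈ S → F n + e n < P n ∧ min (F n + e n) (Q n - 1) = F n := by
    intro n hn hnS
    have h1 := hPQ n hn
    have h2 := hQ n hn
    have h3 := he n hn
    have h4 := hF.eq_of_mem n hn hnS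
    rw [levelBase, if_pos hnS] at h3
    omega
  have hnot : ∀ n, 1 ≤ n → n ∉ S → e n = 0 ∧ F n < Q n - 1 := by
    intro n hn hnS
    have h3 := he n hn
    rw [levelBase, if_neg hnS] at h3
    exact ⟨by omega, hF.lt_of_notMem n hn hnS⟩
  have hlt : ∀ n, 1 ≤ n → F n + e n < P n := by
    intro n hn
    by_cases hnS : n ∈ S
    · exact (hmem n hn hnS).1
    · have := hnot n hn hnS
      have := hPQ n hn
      omega
  have hmin : ∀ n, 1 ≤ n → min (F n + e n) (Q n - 1) = F n := by
    intro n hn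
    by_cases hnS : n ∈ S
    · exact (hmem n hn hnS).2
    · have := hnot n hn hnS
      omega
  -- Off `S` the digit is below `q_n - 1 < p_n - 1`, so the series is a genuine `P`-expansion.
  have hmax : ∀ N, ∃ n, N ≤ n ∧ 1 ≤ n ∧ F n + e n ≠ P n - 1 := by
    intro N
    obtain ⟨n, h1, h2, h3⟩ := hS N
    have h4 := hnot n h2 h3
    have := hPQ n h2
    exact ⟨n, h1, h2, by omega⟩
  have hdig : ∀ n, 1 ≤ n → cantorDigit P (cantorVal P fun n => F n + e n) n = F n + e n :=
    fun n hn => cantorDigit_cantorVal hP hlt hmax hn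
  have hIco := cantorVal_mem_Ico hP hlt hmax
  -- The point 0 is excluded because all its digits vanish, while some `F n` does not.
  refine ⟨⟨lt_of_le_of_ne hIco.1 fun h0 => ?_, hIco.2⟩, ?_⟩
  · obtain ⟨n, -, hn, hne⟩ := hF.frequently_ne_zero 0
    have := hdig n hn
    rw [← h0] at this
    simp [cantorDigit] at this
    omega
  · rw [psi_eq_cantorVal P hQ]
    refine tsum_congr fun n => ?_
    beta_reduce
    rw [hdig (n + 1) (by omega), hmin (n + 1) (by omega)]

/-- The truncated digits of `x` might end in maximal digits, hence the appeal to
`digits_eq_of_cantorVal_eq`. It gives `min (E_n) (q_n - 1) = F n`, which pins `E_n` off `S` and only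
bounds it below on `S`. -/
theorem IsLevelDigits.digit_mem {P Q F : ℕ → ℕ} {S : Set ℕ} (hP : IsBasicSequence P)
    (hQ : IsBasicSequence Q) (hS : ∀ N, ∃ n, N ≤ n ∧ 1 ≤ n ∧ n ∉ S)
    (hF : IsLevelDigits Q S F) {x : ℝ} (hx : x ∈ levelSet P Q (cantorVal Q F)) {n : ℕ}
    (hn : 1 ≤ n) : cantorDigit P x n ∈ Finset.Ico (F n) (F n + levelBase P Q S n) := by
  have hmax : ∀ N, ∃ n, N ≤ n ∧ 1 ≤ n ∧ F n ≠ Q n - 1 := fun N => by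
    obtain ⟨n, h1, h2, h3⟩ := hS N
    exact ⟨n, h1, h2, (hF.lt_of_notMem n h2 h3).ne⟩
  have h1 := hx.2
  rw [psi_eq_cantorVal P hQ] at h1
  have h2 := digits_eq_of_cantorVal_eq hQ (hF.lt hQ) (fun n hn => by
    have := hQ n hn
    omega) hmax hF.frequently_ne_zero h1 hn
  have h3 := cantorDigit_lt hP x hn
  have h4 := hQ n hn
  rw [Finset.mem_Ico, levelBase]
  split_ifs with hnS
  · have := hF.eq_of_mem n hn hnS
    omega
  · have := hF.lt_of_notMem n hn hnS
    omega

section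

variable {P Q : ℕ → ℕ} {γ ρ : ℝ}

theorem one_le_levelBase (P Q : ℕ → ℕ) (S : Set ℕ) (n : ℕ) : 1 ≤ levelBase P Q S n := by
  unfold levelBase
  split_ifs <;> omega

theorem tendsto_log_levelBase_div (hP : IsBasicSequence P)
    (hPnice : GrowsNicely (fun n => (P n : ℝ))) (hPQ : ∀ n, 1 ≤ n → Q n < P n)
    (hlim : Tendsto (fun n => Real.log ((P n : ℝ) - (Q n : ℝ)) / Real.log (P n : ℝ))
      atTop (𝓝 γ)) (hρ : ρ ∈ Icc (0 : ℝ) 1) :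
    Tendsto (fun n => Real.log (cantorProd (levelBase P Q (jumpSet ρ)) n) /
        Real.log (cantorProd P n)) atTop (𝓝 (γ * ρ)) ∧
      Tendsto (fun n => Real.log (cantorProd (levelBase P Q (jumpSet ρ)) n) /
        Real.log (cantorProd P (n + 1))) atTop (𝓝 (γ * ρ)) := by
  classical
  have hge : ∀ᶠ n in atTop, (1 : ℝ) ≤ (P n : ℝ) - Q n := by
    filter_upwards [eventually_ge_atTop 1] with n hn
    have : (Q n : ℝ) + 1 ≤ P n := by exact_mod_cast hPQ n hn
    linarith
  refine tendsto_log_cantorProd_div hP hPnice (fun n _ => one_le_levelBase P Q _ n)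
    (θ := fun k => if k + 1 ∈ jumpSet ρ then 1 else 0)
    (l := fun n => Real.log ((P n : ℝ) - Q n + 1)) (fun n => ?_)
    (abs_sum_jumpSet_sub_le hρ) (fun k => ?_) ?_
  · split_ifs <;> norm_num
  · rw [levelBase]
    split_ifs
    · have := hPQ (k + 1) (by omega)
      rw [one_mul, Nat.cast_add, Nat.cast_sub this.le, Nat.cast_one]
    · simp
  · refine tendsto_log_div_of_le_of_le hPnice.2.1 hlim (c := 2) (by norm_num) ?_ ?_ ?_ ?_ <;>
    · filter_upwards [hge] with n hn
      linarith

theorem IsLevelDigits.dimH_levelSet (hP : IsBasicSequence P) (hQ : IsBasicSequence Q)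
    (hPnice : GrowsNicely (fun n => (P n : ℝ))) (hPQ : ∀ n, 1 ≤ n → Q n < P n)
    (hlim : Tendsto (fun n => Real.log ((P n : ℝ) - (Q n : ℝ)) / Real.log (P n : ℝ))
      atTop (𝓝 γ)) (hρ : ρ ∈ Ico (0 : ℝ) 1) {F : ℕ → ℕ} (hF : IsLevelDigits Q (jumpSet ρ) F) :
    dimH (levelSet P Q (cantorVal Q F)) = ENNReal.ofReal (γ * ρ) := by
  have hS := exists_notMem_jumpSet hρ
  have hlog := tendsto_log_levelBase_div hP hPnice hPQ hlim ⟨hρ.1, hρ.2.le⟩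
  refine le_antisymm ?_ ?_
  · refine dimH_le_ofReal_of_tendsto hP (fun n _ => one_le_levelBase P Q _ n)
      (D := fun n => Finset.Ico (F n) (F n + levelBase P Q (jumpSet ρ) n))
      (fun n _ => by simp) hlog.1
      fun x hx => ⟨⟨hx.1.1.le, hx.1.2⟩, fun n hn => hF.digit_mem hP hQ hS hx hn⟩
  · refine ofReal_le_dimH_of_tendsto hP (fun n _ => one_le_levelBase P Q _ n) (a := F)
      (fun n hn => ?_) hlog.2 fun e he => hF.mem_levelSet hP hQ hPQ hS he
    have h1 := hPQ n hn
    have h2 := hQ n hn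
    rw [levelBase]
    split_ifs with h
    · have := hF.eq_of_mem n hn h
      omega
    · have := hF.lt_of_notMem n hn h
      omega

theorem IsLevelDigits.cantorVal_mem_dimLevelSet (hP : IsBasicSequence P)
    (hQ : IsBasicSequence Q) (hPnice : GrowsNicely (fun n => (P n : ℝ)))
    (hPQ : ∀ n, 1 ≤ n → Q n < P n)
    (hlim : Tendsto (fun n => Real.log ((P n : ℝ) - (Q n : ℝ)) / Real.log (P n : ℝ))
      atTop (𝓝 γ)) (hρ : ρ ∈ Ico (0 : ℝ) 1) {F : ℕ → ℕ} (hF : IsLevelDigits Q (jumpSet ρ) F) :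
    cantorVal Q F ∈ dimLevelSet P Q (γ * ρ) := by
  have h := hF.mem_levelSet (e := fun _ => 0) hP hQ hPQ (exists_notMem_jumpSet hρ)
    fun n _ => one_le_levelBase P Q _ n
  exact ⟨⟨_, h.1, h.2⟩, hF.dimH_levelSet hP hQ hPnice hPQ hlim hρ⟩

/-! ### A large set of values `w`. -/

/-- The number of digits allowed off `S` for the points `w`. -/
noncomputable def valueBase (Q : ℕ → ℕ) (S : Set ℕ) (n : ℕ) : ℕ :=
  open Classical in if n ∈ S then 1 else max (Q n - 2) 1

/-- The least digit allowed for the points `w`. -/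
noncomputable def valueDigit (Q : ℕ → ℕ) (S : Set ℕ) (n : ℕ) : ℕ :=
  open Classical in if n ∈ S then Q n - 1 else min (Q n - 2) 1

theorem one_le_valueBase (Q : ℕ → ℕ) (S : Set ℕ) (n : ℕ) : 1 ≤ valueBase Q S n := by
  unfold valueBase
  split_ifs <;> omega

/-- Off `S` the digits run over `1, …, q_n - 2`, avoiding both extremes; if `q_n = 2` only the digit
0 remains, which happens finitely often as `q_n → ∞`. -/
theorem isLevelDigits_valueDigit_add (hQ : IsBasicSequence Q)
    (hQinf : Tendsto (fun n => (Q n : ℝ)) atTop atTop) (S : Set ℕ) {e : ℕ → ℕ}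
    (he : ∀ n, 1 ≤ n → e n < valueBase Q S n) :
    IsLevelDigits Q S (fun n => valueDigit Q S n + e n) where
  eq_of_mem n hn h := by
    have := he n hn
    rw [valueBase, if_pos h] at this
    simp only [valueDigit, if_pos h]
    omega
  lt_of_notMem n hn h := by
    have h1 := he n hn
    have h2 := hQ n hn
    rw [valueBase, if_neg h] at h1
    simp only [valueDigit, if_neg h]
    omega
  frequently_ne_zero N := by
    obtain ⟨n, h1, h2⟩ := ((hQinf.eventually_gt_atTop 2).and
      (eventually_ge_atTop (N + 1))).exists
    have h3 : 2 < Q n := by exact_mod_cast h1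
    refine ⟨n, by omega, by omega, ?_⟩
    simp only [valueDigit]
    split_ifs <;> omega

theorem tendsto_log_valueBase_div (hQ : IsBasicSequence Q)
    (hQnice : GrowsNicely (fun n => (Q n : ℝ))) (hρ : ρ ∈ Icc (0 : ℝ) 1) :
    Tendsto (fun n => Real.log (cantorProd (valueBase Q (jumpSet ρ)) n) /
        Real.log (cantorProd Q (n + 1))) atTop (𝓝 (1 - ρ)) := by
  classical
  have hQinf := hQnice.2.1
  have hlog : Tendsto (fun n => Real.log (Q n : ℝ)) atTop atTop :=
    Real.tendsto_log_atTop.comp hQinf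
  rw [← one_mul (1 - ρ)]
  refine (tendsto_log_cantorProd_div hQ hQnice (fun n _ => one_le_valueBase Q _ n)
    (θ := fun k => 1 - if k + 1 ∈ jumpSet ρ then 1 else 0)
    (l := fun n => Real.log ((max (Q n - 2) 1 : ℕ) : ℝ)) (fun n => ?_)
    (fun n => ?_) (fun k => ?_) ?_).2
  · split_ifs <;> norm_num
  -- The complement of `S` has density `1 - ρ` and the negated discrepancy.
  · have h := abs_sum_jumpSet_sub_le hρ n
    rw [← abs_neg, ← Finset.sum_neg_distrib] at h
    convert h using 3
    ring
  · rw [valueBase]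
    split_ifs <;> simp
  · refine tendsto_log_div_of_le_of_le hQinf (f := fun n => (Q n : ℝ)) (c := 2) ?_
      (by norm_num) (hQinf.eventually_gt_atTop 0) (Eventually.of_forall fun n => ?_) ?_ ?_
    · refine tendsto_const_nhds.congr' ?_
      filter_upwards [hlog.eventually_gt_atTop 0] with n hn
      exact (div_self hn.ne').symm
    · exact_mod_cast (by omega : 0 < max (Q n - 2) 1)
    · filter_upwards [hQinf.eventually_ge_atTop 4] with n hn
      have h4 : 4 ≤ Q n := by exact_mod_cast hn
      exact_mod_cast (by omega : Q n ≤ 2 * max (Q n - 2) 1)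
    · filter_upwards [hQinf.eventually_ge_atTop 4] with n hn
      have h4 : 4 ≤ Q n := by exact_mod_cast hn
      exact_mod_cast (by omega : max (Q n - 2) 1 ≤ 2 * Q n)

theorem ofReal_le_dimH_dimLevelSet (hP : IsBasicSequence P)
    (hQ : IsBasicSequence Q) (hPnice : GrowsNicely (fun n => (P n : ℝ)))
    (hQnice : GrowsNicely (fun n => (Q n : ℝ))) (hPQ : ∀ n, 1 ≤ n → Q n < P n)
    (hlim : Tendsto (fun n => Real.log ((P n : ℝ) - (Q n : ℝ)) / Real.log (P n : ℝ))
      atTop (𝓝 γ)) (hρ : ρ ∈ Ico (0 : ℝ) 1) :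
    ENNReal.ofReal (1 - ρ) ≤ dimH (dimLevelSet P Q (γ * ρ)) := by
  refine ofReal_le_dimH_of_tendsto hQ (fun n _ => one_le_valueBase Q _ n)
    (a := valueDigit Q (jumpSet ρ)) (fun n hn => ?_)
    (tendsto_log_valueBase_div hQ hQnice ⟨hρ.1, hρ.2.le⟩) fun e he =>
      (isLevelDigits_valueDigit_add hQ hQnice.2.1 _ he).cantorVal_mem_dimLevelSet
        hP hQ hPnice hPQ hlim hρ
  have := hQ n hn
  rw [valueBase, valueDigit]
  split_ifs <;> omega

end

theorem mainTheorem6 (P Q : ℕ → ℕ) (hP : IsBasicSequence P) (hQ : IsBasicSequence Q)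
    (hPnice : GrowsNicely (fun n => (P n : ℝ)))
    (hQnice : GrowsNicely (fun n => (Q n : ℝ)))
    (hRnice : GrowsNicely (fun n => (P n : ℝ) - (Q n : ℝ)))
    (hPQ : ∀ n, 1 ≤ n → Q n < P n)
    (γ : ℝ) (hγ : γ ∈ Set.Ioc (0 : ℝ) 1)
    (hlim : Tendsto (fun n => Real.log ((P n : ℝ) - (Q n : ℝ)) / Real.log (P n : ℝ))
      atTop (𝓝 γ)) :
    ∀ α ∈ Set.Icc (0 : ℝ) 1,
      ENNReal.ofReal (1 - α / γ) ≤ dimH (dimLevelSet P Q α) ∧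
        (α < γ → 0 < dimH (dimLevelSet P Q α)) := by
  intro α hα
  have key : α < γ → ENNReal.ofReal (1 - α / γ) ≤ dimH (dimLevelSet P Q α) := fun h => by
    have hρ : α / γ ∈ Ico (0 : ℝ) 1 := ⟨div_nonneg hα.1 hγ.1.le, (div_lt_one hγ.1).2 h⟩
    have := ofReal_le_dimH_dimLevelSet hP hQ hPnice hQnice hPQ hlim hρ
    rwa [mul_div_cancel₀ α hγ.1.ne'] at this
  refine ⟨?_, fun h => lt_of_lt_of_le ?_ (key h)⟩
  · rcases lt_or_ge α γ with h | h
    · exact key h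
    · rw [ENNReal.ofReal_of_nonpos]
      · exact zero_le
      · linarith [(one_le_div hγ.1).2 h]
  · rw [ENNReal.ofReal_pos]
    linarith [(div_lt_one hγ.1).2 h]
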